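/- Graphs are finite, undirected and loopless, possibly with multiple edges. A nowhere-zero $4$-flow of a graph $\Gamma$ consists of an orientation of $\Gamma$ and a map $\varphi\colon E(\Gamma)\to\mathbb{Z}$ with $0<|\varphi(e)|<4$ for every edge $e$ such that, at every vertex $v$, the sum of $\varphi(e)$ over the edges $e$ with tail $v$ equals the sum of $\varphi(e)$ over the edges $e$ with head $v$. Theorem. Let $\Gamma_1$ and $\Gamma_2$ be two subgraphs of a graph $\Gamma$ such that $\Gamma=\Gamma_1\cup\Gamma_2$ (that is, $V(\Gamma)=V(\Gamma_1)\cup V(\Gamma_2)$ and $E(\Gamma)=E(\Gamma_1)\cup E(\Gamma_2)$), $|E(\Gamma_1)\cap E(\Gamma_2)|\le 3$, and the subgraph of $\Gamma$ consisting of the edges in $E(\Gamma_1)\cap E(\Gamma_2)$ and their ends is connected (the empty graph counts as connected). If both $\Gamma_1$ and $\Gamma_2$ admit nowhere-zero $4$-flows, then $\Gamma$ admits a nowhere-zero $4$-flow. -/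

import Mathlib

namespace Graph

open scoped Graph

/-- An orientation of a multigraph `G`: every edge of `G` is endowed with a tail and a head, which
are its two ends. -/
structure Orientation {α β : Type*} (G : Graph α β) where
  tail : E(G) → α
  head : E(G) → α
  isLink : ∀ e : E(G), G.IsLink e (tail e) (head e)

/-- `(D, φ)` is an `A`-flow of `G`: at every vertex `v`, the sum of `φ` over the edges with tail `v`
equals the sum of `φ` over the edges with head `v`. (Used for graphs with finitely many edges.) -/
def IsFlow {α β A : Type*} [AddCommGroup A] {G : Graph α β} (D : G.Orientation) (φ : E(G) → A) :
    Prop :=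
  ∀ v ∈ V(G), ∑ᶠ (e : E(G)) (_ : D.tail e = v), φ e = ∑ᶠ (e : E(G)) (_ : D.head e = v), φ e

/-- `G` admits a nowhere-zero `k`-flow: for some orientation there is an integer flow `φ` with
`0 < |φ e| < k` for every edge `e`. -/
def HasNowhereZeroFlow {α β : Type*} (G : Graph α β) (k : ℕ) : Prop :=
  ∃ (D : G.Orientation) (φ : E(G) → ℤ),
    IsFlow D φ ∧ ∀ e : E(G), φ e ≠ 0 ∧ |φ e| < (k : ℤ)

/-- The union of `H₁` and `H₂`, two subgraphs of `G`, is `G`. -/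
structure IsUnionOf {α β : Type*} (G H₁ H₂ : Graph α β) : Prop where
  left_le : H₁ ≤ G
  right_le : H₂ ≤ G
  vertexSet_eq : V(G) = V(H₁) ∪ V(H₂)
  edgeSet_eq : E(G) = E(H₁) ∪ E(H₂)

/-- The subgraph `G[F]` of `G` induced by a set `F` of edges: its edges are those of `F`, its
vertices are the ends of the edges in `F`. -/
def edgeInduce {α β : Type*} (G : Graph α β) (F : Set β) : Graph α β where
  vertexSet := {x | ∃ e ∈ F, G.Inc e x}
  edgeSet := F ∩ E(G)
  IsLink e x y := e ∈ F ∧ G.IsLink e x y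
  isLink_symm _ _ := ⟨fun _ _ h => ⟨h.1, h.2.symm⟩⟩
  eq_or_eq_of_isLink_of_isLink _ _ _ _ _ h h' := h.2.left_eq_or_eq h'.2
  edge_mem_iff_exists_isLink e := by
    simp [G.edge_mem_iff_exists_isLink e]
  left_mem_of_isLink e _ y h := ⟨e, h.1, y, h.2⟩

/-- `G` is connected: any two vertices of `G` are joined by a path, which only depends on which pairs
of distinct vertices are adjacent. The graph without vertices counts as connected. -/
def IsConnected {α β : Type*} (G : Graph α β) : Prop :=
  G.toSimpleGraph.Preconnected

end Graph

/-!
A nowhere-zero integer 4-flow exists if and only if there is a nowhere-zero flow with values in the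
Klein four-group `K = ℤ/2 × ℤ/2` (`Graph.exists_kleinFlow_of_intFlow`,
`Graph.exists_intFlow_of_kleinFlow`). Both directions rest on the fact that a flow modulo 2 lifts
to an integer flow with values in `{-1, 0, 1}`, that is, on Eulerian orientations
(`Graph.exists_eulerian_signs`).

Let `f₁`, `f₂` be Klein flows of the two subgraphs, extended by zero. Then `f₁ + σ f₂`, for an
automorphism `σ` of `K`, is nowhere zero unless `f₁ e = σ (f₂ e)` for some common edge `e`. With at
most three common edges, some of the six `σ` works (`Graph.exists_kleinFlow_of_agree`) unless
there are exactly three, one of the flows is constant on them, and the other one, say `f₂`, takes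
three distinct values.

In that case connectedness gives a common edge `x` that meets the two others, `y` and `z`. If the
three edges form a star, a parity argument finds a cycle in two of the colours of `f₁` that
separates them, and exchanging these colours on it makes `f₁` nonconstant
(`Graph.exists_kleinFlow_of_star`). Otherwise both ends of `x` are on edges of the colours other
than `f₂ x`. Either these colours of `f₂` join the ends of `x`, and adding `f₂ x` along the cycle
so formed repairs a sum `σ f₁ + f₂` that vanishes only at `x`; or they separate `y` from `z`, and
exchanging them on the component of `y` makes `f₂` noninjective on the common edges
(`Graph.exists_kleinFlow_of_covered`).

Instead of paths and cycles, the proof uses functions from the edges to `ℤ/2` with a prescribed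
boundary (`Graph.Joined`).
-/

namespace Graph

open Finsupp

/-! ### Boundaries and flows -/

section Boundary

variable {α ι M N : Type*} [AddCommGroup M] [AddCommGroup N]

/-- The boundary of the edge weighting `f`, where the edge `e` goes from `t e` to `h e`: the formal
sum of vertices whose coefficient at `v` is the inflow of `f` minus its outflow at `v`. -/
noncomputable def boundary [Fintype ι] (t h : ι → α) (f : ι → M) : α →₀ M :=
  ∑ e, (single (h e) (f e) - single (t e) (f e))

variable [Fintype ι] (t h : ι → α)

lemma boundary_zero : boundary t h (0 : ι → M) = 0 := by
  simp [boundary]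

lemma boundary_add (f g : ι → M) : boundary t h (f + g) = boundary t h f + boundary t h g := by
  simp only [boundary, Pi.add_apply, single_add, ← Finset.sum_add_distrib]
  exact Finset.sum_congr rfl fun e _ => by abel

lemma boundary_comp (φ : M →+ N) (f : ι → M) :
    boundary t h (fun e => φ (f e)) = mapRange.addMonoidHom φ (boundary t h f) := by
  simp [boundary, map_sum, map_sub]

lemma boundary_comp_eq_zero (φ : M →+ N) {f : ι → M} (hf : boundary t h f = 0) :
    boundary t h (fun e => φ (f e)) = 0 := by
  rw [boundary_comp, hf, map_zero]

lemma boundary_pi_single [DecidableEq ι] (e : ι) (m : M) :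
    boundary t h (Pi.single e m) = single (h e) m - single (t e) m := by
  rw [boundary, Finset.sum_eq_single e]
  · simp
  · intro b _ hb
    simp [Pi.single_eq_of_ne hb]
  · simp

lemma boundary_apply [DecidableEq α] (f : ι → M) (v : α) :
    boundary t h f v = ∑ e, (if h e = v then f e else 0) - ∑ e, (if t e = v then f e else 0) := by
  rw [boundary, finsetSum_apply, ← Finset.sum_sub_distrib]
  exact Finset.sum_congr rfl fun e _ => by simp [Finsupp.single_apply]

/-- Restricting a flow to the edges inside a vertex set `X` that none of its edges leaves gives a
flow. -/
lemma boundary_restrict {f : ι → M} (hf : boundary t h f = 0) (X : α → Prop) [DecidablePred X]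
    (hX : ∀ e, f e ≠ 0 → (X (t e) ↔ X (h e))) :
    boundary t h (fun e => if X (t e) then f e else 0) = 0 := by
  have key : boundary t h (fun e => if X (t e) then f e else 0)
      = filterAddHom X (boundary t h f) := by
    rw [boundary, boundary, map_sum]
    refine Finset.sum_congr rfl fun e _ => ?_
    rw [map_sub]
    change _ = filter X _ - filter X _
    by_cases h0 : f e = 0
    · simp [h0]
    by_cases hx : X (t e)
    · rw [if_pos hx, filter_single_of_pos _ hx, filter_single_of_pos _ ((hX e h0).1 hx)]
    · rw [if_neg hx, filter_single_of_neg _ hx,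
        filter_single_of_neg _ fun h' => hx ((hX e h0).2 h')]
      simp
  rw [key, hf, map_zero]

end Boundary

/-! ### Integer 4-flows and Klein flows -/

section Parity

variable {α ι : Type*}

/-- An even multigraph has an Eulerian orientation: here `S` is the edge set, and `s e = 1` means
that `e` is directed from `t e` to `h e`. Two edges that meet at a vertex `v` are spliced into a
single edge that avoids `v`, and the induction hypothesis orients the result. -/
lemma exists_eulerian_signs (S : Finset ι) : ∀ t h : ι → α,
    ∑ e ∈ S, (single (h e) (1 : ZMod 2) - single (t e) 1) = 0 →
    ∃ s : ι → ℤ, (∀ e, s e = 1 ∨ s e = -1) ∧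
      ∑ e ∈ S, (single (h e) (s e) - single (t e) (s e)) = 0 := by
  classical
  induction S using Finset.strongInduction with
  | H S ih =>
  intro t h hS
  obtain rfl | ⟨a, ha⟩ := S.eq_empty_or_nonempty
  · exact ⟨fun _ => 1, by simp, by simp⟩
  by_cases hloop : t a = h a
  · obtain ⟨s, hs, hs'⟩ := ih _ (Finset.erase_ssubset ha) t h (by
      rw [← Finset.add_sum_erase _ _ ha] at hS
      simpa [hloop] using hS)
    refine ⟨s, hs, ?_⟩
    rw [← Finset.add_sum_erase _ _ ha, hs', hloop]
    simp
  have hex : ∃ b ∈ S.erase a, h b = h a ∨ t b = h a := by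
    by_contra! hno
    have h1 := DFunLike.congr_fun hS (h a)
    rw [← Finset.add_sum_erase _ _ ha, Finsupp.add_apply, finsetSum_apply, Finset.sum_eq_zero] at h1
    · simp [hloop] at h1
    · intro b hb
      simp [hno b hb]
  obtain ⟨b, hb, hab⟩ := hex
  have hba : b ≠ a := Finset.ne_of_mem_erase hb
  have hss := Finset.erase_ssubset ha
  rw [← Finset.add_sum_erase _ _ ha, ← Finset.add_sum_erase _ _ hb] at hS
  -- Changing the ends of `b` does not affect the contribution of the remaining edges.
  have hrest : ∀ {R : Type} [Ring R] (t' h' : ι → α) (s s' : ι → R),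
      (∀ e, e ≠ a → e ≠ b → t' e = t e ∧ h' e = h e ∧ s' e = s e) →
      ∑ e ∈ (S.erase a).erase b, (single (h' e) (s' e) - single (t' e) (s' e))
        = ∑ e ∈ (S.erase a).erase b, (single (h e) (s e) - single (t e) (s e)) := by
    intro R _ t' h' s s' H
    refine Finset.sum_congr rfl fun e he => ?_
    simp only [Finset.mem_erase] at he
    obtain ⟨h1, h2, h3⟩ := H e he.2.1 he.1
    rw [h1, h2, h3]
  rcases hab with hab | hab
  · obtain ⟨s, hs, hs'⟩ := ih _ hss t (Function.update h b (t a)) (by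
      rw [← Finset.add_sum_erase _ _ hb, hrest t _ (fun _ => 1) (fun _ => 1)
        (fun e _ h2 => by simp [Function.update_of_ne h2])]
      rw [hab] at hS
      rw [← hS, Function.update_self, ← sub_eq_zero]
      ext v
      simp only [coe_add, coe_sub, Pi.add_apply, Pi.sub_apply, Finsupp.zero_apply]
      have h2 : (2 : ZMod 2) = 0 := by decide
      linear_combination (single (t a) (1 : ZMod 2) v - single (h a) (1 : ZMod 2) v) * h2)
    refine ⟨Function.update s a (-s b), fun e => ?_, ?_⟩
    · by_cases he : e = a
      · subst he
        rcases hs b with h | h <;> simp [h]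
      · simpa [Function.update_of_ne he] using hs e
    rw [← Finset.add_sum_erase _ _ hb, hrest _ _ s s
        (fun e _ h2 => by simp [Function.update_of_ne h2])] at hs'
    rw [← Finset.add_sum_erase _ _ ha, ← Finset.add_sum_erase _ _ hb, hrest _ _ s _
        (fun e h1 _ => by simp [Function.update_of_ne h1]), ← hs', hab]
    simp only [Function.update_self, Function.update_of_ne hba, single_neg]
    abel
  · obtain ⟨s, hs, hs'⟩ := ih _ hss (Function.update t b (t a)) h (by
      rw [← Finset.add_sum_erase _ _ hb, hrest _ h (fun _ => 1) (fun _ => 1)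
        (fun e _ h2 => by simp [Function.update_of_ne h2])]
      rw [hab] at hS
      rw [← hS, Function.update_self]
      abel)
    refine ⟨Function.update s a (s b), fun e => ?_, ?_⟩
    · by_cases he : e = a
      · subst he
        simpa using hs b
      · simpa [Function.update_of_ne he] using hs e
    rw [← Finset.add_sum_erase _ _ hb, hrest _ _ s s
        (fun e _ h2 => by simp [Function.update_of_ne h2])] at hs'
    rw [← Finset.add_sum_erase _ _ ha, ← Finset.add_sum_erase _ _ hb, hrest _ _ s _
        (fun e h1 _ => by simp [Function.update_of_ne h1]), ← hs', hab]
    simp only [Function.update_self, Function.update_of_ne hba]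
    abel

variable [Fintype ι] {t h : ι → α}

/-- Every flow modulo 2 lifts to an integer flow with values in `{-1, 0, 1}`. -/
lemma exists_signed_flow {g : ι → ZMod 2} (hg : boundary t h g = 0) :
    ∃ ψ : ι → ℤ, boundary t h ψ = 0 ∧
      ∀ e, (g e = 0 → ψ e = 0) ∧ (g e ≠ 0 → ψ e = 1 ∨ ψ e = -1) := by
  classical
  have h01 : ∀ x : ZMod 2, x ≠ 0 → x = 1 := by decide
  obtain ⟨s, hs, hs'⟩ := exists_eulerian_signs (Finset.univ.filter fun e => g e ≠ 0) t h (by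
    rw [Finset.sum_filter]
    refine Eq.trans (Finset.sum_congr rfl fun e _ => ?_) hg
    by_cases he : g e = 0
    · simp [he]
    · rw [if_pos he, h01 _ he])
  refine ⟨fun e => if g e = 0 then 0 else s e, ?_, fun e => ⟨fun he => by simp [he], fun he => by
    simpa [he] using hs e⟩⟩
  rw [Finset.sum_filter] at hs'
  rw [← hs', boundary]
  refine Finset.sum_congr rfl fun e _ => ?_
  by_cases he : g e = 0 <;> simp [he]

/-- The Klein four-group `ℤ/2 × ℤ/2`. -/
abbrev KleinFour := ZMod 2 × ZMod 2

/-- A nowhere-zero integer 4-flow `φ` gives a nowhere-zero Klein flow: with `ψ` a signed lift of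
`φ` modulo 2, take `φ` and `(φ + ψ) / 2` modulo 2. -/
lemma exists_kleinFlow_of_intFlow {φ : ι → ℤ} (hφ : boundary t h φ = 0)
    (h0 : ∀ e, φ e ≠ 0 ∧ |φ e| < 4) :
    ∃ f : ι → KleinFour, boundary t h f = 0 ∧ ∀ e, f e ≠ 0 := by
  have hmod := boundary_comp_eq_zero t h (Int.castAddHom (ZMod 2)) hφ
  obtain ⟨ψ, hψ, hψ'⟩ := exists_signed_flow hmod
  simp only [Int.coe_castAddHom, ZMod.intCast_zmod_eq_zero_iff_dvd, Ne,
    ZMod.intCast_zmod_eq_zero_iff_dvd] at hψ'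
  have hval : ∀ e, ∃ c : ℤ, φ e + ψ e = c + c ∧ (2 ∣ φ e → ¬ 2 ∣ c) := by
    intro e
    obtain ⟨h1, h2⟩ := hψ' e
    obtain ⟨h3, h4⟩ := h0 e
    rw [abs_lt] at h4
    push_cast at h1 h2
    refine ⟨(φ e + ψ e) / 2, ?_, ?_⟩ <;> omega
  choose χ hχ hχ' using hval
  have hχ0 : boundary t h χ = 0 := by
    have h2 : boundary t h χ + boundary t h χ = 0 := by
      rw [← boundary_add, ← show φ + ψ = χ + χ from funext hχ, boundary_add, hφ, hψ, add_zero]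
    ext v
    have h3 := DFunLike.congr_fun h2 v
    simp only [coe_add, Pi.add_apply, Finsupp.zero_apply] at h3 ⊢
    omega
  have hf := congrArg₂ (· + ·)
    (boundary_comp_eq_zero t h ((AddMonoidHom.inl (ZMod 2) (ZMod 2)).comp (Int.castAddHom _)) hφ)
    (boundary_comp_eq_zero t h ((AddMonoidHom.inr (ZMod 2) (ZMod 2)).comp (Int.castAddHom _)) hχ0)
  refine ⟨fun e => ((φ e : ZMod 2), (χ e : ZMod 2)), ?_, fun e he => ?_⟩
  · simp only [← boundary_add, add_zero] at hf
    rw [← hf]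
    congr 1
    ext e <;> simp
  · simp only [Prod.mk_eq_zero, ZMod.intCast_zmod_eq_zero_iff_dvd] at he
    exact hχ' e (by exact_mod_cast he.1) (by exact_mod_cast he.2)

/-- A nowhere-zero Klein flow gives a nowhere-zero integer 4-flow `ψ₁ + 2 ψ₂`, where `ψ₁`, `ψ₂` are
signed lifts of the two coordinates. -/
lemma exists_intFlow_of_kleinFlow {f : ι → KleinFour} (hf : boundary t h f = 0)
    (h0 : ∀ e, f e ≠ 0) :
    ∃ φ : ι → ℤ, boundary t h φ = 0 ∧ ∀ e, φ e ≠ 0 ∧ |φ e| < 4 := by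
  obtain ⟨ψ₁, h1, h1'⟩ := exists_signed_flow
    (boundary_comp_eq_zero t h (AddMonoidHom.fst (ZMod 2) (ZMod 2)) hf)
  obtain ⟨ψ₂, h2, h2'⟩ := exists_signed_flow
    (boundary_comp_eq_zero t h (AddMonoidHom.snd (ZMod 2) (ZMod 2)) hf)
  refine ⟨ψ₁ + (ψ₂ + ψ₂), by simp [boundary_add, h1, h2], fun e => ?_⟩
  obtain ⟨ha, hb⟩ := h1' e
  obtain ⟨hc, hd⟩ := h2' e
  have hne : ¬ ((f e).1 = 0 ∧ (f e).2 = 0) := fun h' => h0 e (Prod.ext h'.1 h'.2)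
  simp only [AddMonoidHom.coe_fst, AddMonoidHom.coe_snd] at ha hb hc hd
  simp only [Pi.add_apply, abs_lt]
  by_cases hf1 : (f e).1 = 0
  · have := ha hf1
    have := hd fun h' => hne ⟨hf1, h'⟩
    omega
  · have := hb hf1
    by_cases hf2 : (f e).2 = 0
    · have := hc hf2
      omega
    · have := hd hf2
      omega

end Parity

/-! ### Joins and cycles modulo 2 -/

section Cycles

variable {α ι : Type*} [Fintype ι] {t h : ι → α}

/-- `x` and `y` are joined by edges of `H`: over `ℤ/2`, some set of edges in `H` has the boundary
`x + y`. Indicator functions of edge sets take the place of paths. -/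
def Joined (t h : ι → α) (H : ι → Prop) (x y : α) : Prop :=
  ∃ k : ι → ZMod 2, (∀ e, k e ≠ 0 → H e) ∧ boundary t h k = single y 1 - single x 1

lemma Joined.refl (H : ι → Prop) (x : α) : Joined t h H x x :=
  ⟨0, by simp, by simp [boundary_zero]⟩

lemma Joined.symm {H : ι → Prop} {x y : α} : Joined t h H x y → Joined t h H y x := by
  rintro ⟨k, hk, hk'⟩
  refine ⟨fun e => -AddMonoidHom.id (ZMod 2) (k e), fun e he => hk e (by simpa using he), ?_⟩
  have := boundary_comp t h (-AddMonoidHom.id (ZMod 2)) k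
  simp only [AddMonoidHom.neg_apply] at this
  rw [this, hk']
  ext v
  simp

lemma Joined.trans {H : ι → Prop} {x y z : α} :
    Joined t h H x y → Joined t h H y z → Joined t h H x z := by
  rintro ⟨k, hk, hk'⟩ ⟨l, hl, hl'⟩
  refine ⟨k + l, fun e he => ?_, by rw [boundary_add, hk', hl']; abel⟩
  by_cases h0 : k e = 0
  · exact hl e fun h1 => he (by simp [h0, h1])
  · exact hk e h0

lemma joined_of_edge {H : ι → Prop} {e : ι} (he : H e) : Joined t h H (t e) (h e) := by
  classical
  refine ⟨Pi.single e 1, fun a ha => ?_, boundary_pi_single t h e 1⟩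
  by_cases hae : a = e
  · exact hae ▸ he
  · simp [hae] at ha

lemma joined_iff_of_edge {H : ι → Prop} {x : α} {e : ι} (he : H e) :
    Joined t h H x (t e) ↔ Joined t h H x (h e) :=
  ⟨fun h' => h'.trans (joined_of_edge he), fun h' => h'.trans (joined_of_edge he).symm⟩

/-- The ends of the edge `e` are `x` and `y`. -/
def HasEnds (t h : ι → α) (e : ι) (x y : α) : Prop :=
  (t e = x ∧ h e = y) ∨ (t e = y ∧ h e = x)

/-- Closing up: if the ends of an edge `e` outside `H` are joined in `H`, there is a cycle through
`e` whose other edges are in `H`. -/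
lemma Joined.exists_cycle {H : ι → Prop} {e : ι} {x y : α} (hxy : Joined t h H x y)
    (he : HasEnds t h e x y) (hH : ¬ H e) :
    ∃ g : ι → ZMod 2, boundary t h g = 0 ∧ g e = 1 ∧ ∀ a, a ≠ e → g a ≠ 0 → H a := by
  classical
  wlog hor : t e = x ∧ h e = y generalizing x y
  · exact this hxy.symm he.symm (he.resolve_left hor)
  obtain ⟨rfl, rfl⟩ := hor
  obtain ⟨k, hk, hk'⟩ := hxy.symm
  refine ⟨k + Pi.single e 1, ?_, ?_, fun a ha h0 => hk a (by simpa [ha] using h0)⟩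
  · rw [boundary_add, hk', boundary_pi_single]
    abel
  · have : k e = 0 := by
      by_contra h0
      exact hH (hk e h0)
    simp [this]

/-- Closing up a join along two edges `a`, `b` that meet at `v`. -/
lemma Joined.exists_cycle_two {H : ι → Prop} {a b : ι} {v x y : α} (hxy : Joined t h H x y)
    (ha : HasEnds t h a v x) (hb : HasEnds t h b v y) (hab : a ≠ b) (hHa : ¬ H a) :
    ∃ g : ι → ZMod 2, boundary t h g = 0 ∧ g a = 1 ∧
      ∀ e, e ≠ a → g e ≠ 0 → H e ∨ e = b := by
  have hb' : Joined t h (fun e => H e ∨ e = b) v y := by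
    have := joined_of_edge (t := t) (h := h) (H := fun e => H e ∨ e = b) (Or.inr (rfl : b = b))
    rcases hb with ⟨h1, h2⟩ | ⟨h1, h2⟩
    · rwa [h1, h2] at this
    · rw [h1, h2] at this
      exact this.symm
  have hxy' : Joined t h (fun e => H e ∨ e = b) x y := by
    obtain ⟨k, hk, hk'⟩ := hxy
    exact ⟨k, fun e he => Or.inl (hk e he), hk'⟩
  exact (hb'.trans hxy'.symm).exists_cycle ha (by simp [hHa, hab])

/-- A cycle cannot enter a vertex set `X` exactly once. -/
lemma not_crossing_once {g : ι → ZMod 2} (hg : boundary t h g = 0) (X : α → Prop) (e : ι)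
    (he : g e ≠ 0) (hcross : ¬ (X (t e) ↔ X (h e)))
    (hX : ∀ a, a ≠ e → g a ≠ 0 → (X (t a) ↔ X (h a))) : False := by
  classical
  have h1 := congrArg (linearCombination (ZMod 2) fun v => if X v then (1 : ZMod 2) else 0) hg
  rw [boundary, map_sum, Finset.sum_eq_single e] at h1
  · by_cases hx : X (t e) <;> by_cases hy : X (h e) <;> simp_all
  · intro a _ ha
    by_cases h0 : g a = 0
    · simp [h0]
    · have := hX a ha h0
      by_cases hx : X (t a) <;> simp_all
  · simp

end Cycles

/-! ### The Klein four-group -/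

section Klein

/-- The endomorphism of the Klein four-group that maps the standard basis to `p`, `q`. -/
def kleinEnd (p q : KleinFour) : KleinFour →+ KleinFour where
  toFun x := (x.1 * p.1 + x.2 * q.1, x.1 * p.2 + x.2 * q.2)
  map_zero' := by simp
  map_add' x y := by
    simp only [Prod.fst_add, Prod.snd_add, Prod.mk_add_mk, Prod.mk.injEq]
    constructor <;> ring

/-- The determinant with first row `b`: for `b ≠ 0`, a functional on the Klein four-group with
kernel `{0, b}`. -/
def kleinDet (b : KleinFour) : KleinFour →+ ZMod 2 where
  toFun x := b.1 * x.2 - b.2 * x.1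
  map_zero' := by simp
  map_add' x y := by
    simp only [Prod.fst_add, Prod.snd_add]
    ring

/-- Multiples of an element of the Klein four-group. -/
def kleinMul (b : KleinFour) : ZMod 2 →+ KleinFour where
  toFun r := (r * b.1, r * b.2)
  map_zero' := by simp
  map_add' x y := by
    simp only [Prod.mk_add_mk, Prod.mk.injEq]
    constructor <;> ring

lemma kleinMul_one (b : KleinFour) : kleinMul b 1 = b := by
  simp [kleinMul]

lemma kleinDet_kleinMul (b : KleinFour) (r : ZMod 2) : kleinDet b (kleinMul b r) = 0 := by
  simp only [kleinDet, kleinMul, AddMonoidHom.coe_mk, ZeroHom.coe_mk]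
  ring

lemma kleinDet_ne_zero_iff : ∀ b x : KleinFour, b ≠ 0 → (kleinDet b x ≠ 0 ↔ x ≠ 0 ∧ x ≠ b) := by
  decide

set_option maxRecDepth 100000 in
set_option synthInstance.maxSize 10000 in
set_option synthInstance.maxHeartbeats 400000 in
lemma exists_kleinEnd_map : ∀ a b : KleinFour, a ≠ 0 → b ≠ 0 →
    ∃ p q : KleinFour, (∀ x, kleinEnd p q x = 0 → x = 0) ∧ kleinEnd p q a = b := by
  decide

set_option maxRecDepth 100000 in
set_option synthInstance.maxSize 10000 in
set_option synthInstance.maxHeartbeats 400000 in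
/-- Three nonzero elements `a`, `b`, `c` are avoided by an automorphic image of `a'`, `b'`, `c'`.
Each coincidence excludes two of the six automorphisms; under the hypothesis on `a`, `b` the
excluded automorphisms do not exhaust all six. -/
lemma exists_kleinEnd_avoid : ∀ a : KleinFour, a ≠ 0 → ∀ b : KleinFour, b ≠ 0 →
    ∀ c : KleinFour, c ≠ 0 → ∀ a' : KleinFour, a' ≠ 0 → ∀ b' : KleinFour, b' ≠ 0 →
    (a = b ↔ a' = b') → ∀ c' : KleinFour, c' ≠ 0 →
    ∃ p q : KleinFour, (∀ x, kleinEnd p q x = 0 → x = 0) ∧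
      a ≠ kleinEnd p q a' ∧ b ≠ kleinEnd p q b' ∧ c ≠ kleinEnd p q c' := by
  decide +kernel

/-- For `b ≠ 0`, adding `b` exchanges the two elements other than `0` and `b`. -/
lemma add_kleinMul_kleinDet : ∀ b c d : KleinFour, kleinDet b c ≠ 0 → kleinDet b d ≠ 0 → c ≠ d →
    c + kleinMul b (kleinDet b c) = d := by
  decide

lemma KleinFour.add_ne_zero {a b : KleinFour} (hab : a ≠ b) : a + b ≠ 0 := by
  revert a b
  decide

end Klein

/-! ### Combining two Klein flows -/

section Combine

variable {α ι : Type*} [Fintype ι] {t h : ι → α}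

/-- A Kempe change: adding `b` along a cycle `g` whose edges have values other than `0` and `b`
in the flow `f` does not change the support of `f`. -/
lemma kempe_change {f : ι → KleinFour} (hf : boundary t h f = 0) {g : ι → ZMod 2}
    (hg : boundary t h g = 0) (b : KleinFour) (hgf : ∀ e, g e ≠ 0 → kleinDet b (f e) ≠ 0) :
    boundary t h (f + fun e => kleinMul b (g e)) = 0 ∧
      ∀ e, f e ≠ 0 ↔ (f + fun e => kleinMul b (g e)) e ≠ 0 := by
  refine ⟨by rw [boundary_add, hf, boundary_comp_eq_zero t h _ hg, add_zero], fun e => ?_⟩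
  by_cases h0 : g e = 0
  · simp [h0]
  · have h1 := hgf e h0
    refine ⟨fun _ h2 => h1 ?_, fun _ h2 => h1 (by rw [h2, map_zero])⟩
    have h3 := congrArg (kleinDet b) h2
    simpa [kleinDet_kleinMul] using h3

/-- Two flows that cover all edges combine to a nowhere-zero flow if the equality patterns of their
values agree on two of at most three common edges. -/
lemma exists_kleinFlow_of_agree {f₁ f₂ : ι → KleinFour} (h₁ : boundary t h f₁ = 0)
    (h₂ : boundary t h f₂ = 0) (hcov : ∀ e, f₁ e ≠ 0 ∨ f₂ e ≠ 0) {x y z : ι}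
    (hF : ∀ e, f₁ e ≠ 0 → f₂ e ≠ 0 → e = x ∨ e = y ∨ e = z)
    (hx : f₁ x ≠ 0 ∧ f₂ x ≠ 0) (hy : f₁ y ≠ 0 ∧ f₂ y ≠ 0) (hz : f₁ z ≠ 0 ∧ f₂ z ≠ 0)
    (hxy : f₁ x = f₁ y ↔ f₂ x = f₂ y) :
    ∃ f : ι → KleinFour, boundary t h f = 0 ∧ ∀ e, f e ≠ 0 := by
  obtain ⟨p, q, hpq, h1, h2, h3⟩ := exists_kleinEnd_avoid _ hx.1 _ hy.1 _ hz.1 _ hx.2 _ hy.2 hxy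
    _ hz.2
  refine ⟨f₁ + fun e => kleinEnd p q (f₂ e),
    by rw [boundary_add, h₁, boundary_comp_eq_zero t h _ h₂, add_zero], fun e => ?_⟩
  by_cases h0 : f₁ e = 0
  · simp only [Pi.add_apply, h0, zero_add]
    exact fun h' => (hcov e).resolve_left (not_not.2 h0) (hpq _ h')
  by_cases h0' : f₂ e = 0
  · simpa [h0'] using h0
  · refine KleinFour.add_ne_zero ?_
    rcases hF e h0 h0' with rfl | rfl | rfl <;> assumption

variable {f₁ f₂ : ι → KleinFour} {x y z : ι}

/-- If `f₂` takes distinct values at the common edges, where `f₁` is constant, and every end of the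
common edge `x` is an end of `y` or `z`, then there is a nowhere-zero flow. With `b = f₂ x`, the
edges with values of `f₂` other than `0` and `b` include `y` and `z`. If they join the ends of `x`,
then adding `b` along a cycle through `x` repairs the sum of `f₂` and an image of `f₁` that vanishes
only at `x`; otherwise they have a component that contains exactly one of `y` and `z`, and a Kempe
change there makes the values of `f₂` at `y` and `z` equal. -/
lemma exists_kleinFlow_of_covered (h₁ : boundary t h f₁ = 0)
    (h₂ : boundary t h f₂ = 0) (hcov : ∀ e, f₁ e ≠ 0 ∨ f₂ e ≠ 0)
    (hF : ∀ e, f₁ e ≠ 0 → f₂ e ≠ 0 → e = x ∨ e = y ∨ e = z)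
    (hx : f₁ x ≠ 0 ∧ f₂ x ≠ 0) (hy : f₁ y ≠ 0 ∧ f₂ y ≠ 0) (hz : f₁ z ≠ 0 ∧ f₂ z ≠ 0)
    (hxy₁ : f₁ x = f₁ y) (hxz₁ : f₁ x = f₁ z)
    (hxy₂ : f₂ x ≠ f₂ y) (hxz₂ : f₂ x ≠ f₂ z) (hyz₂ : f₂ y ≠ f₂ z)
    (htx : (t x = t y ∨ t x = h y) ∨ (t x = t z ∨ t x = h z))
    (hhx : (h x = t y ∨ h x = h y) ∨ (h x = t z ∨ h x = h z)) :
    ∃ f : ι → KleinFour, boundary t h f = 0 ∧ ∀ e, f e ≠ 0 := by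
  classical
  set b := f₂ x with hb
  let H : ι → Prop := fun e => kleinDet b (f₂ e) ≠ 0
  have hHx : ¬ H x := fun h' => ((kleinDet_ne_zero_iff _ _ hx.2).1 h').2 rfl
  have hHy : H y := (kleinDet_ne_zero_iff _ _ hx.2).2 ⟨hy.2, hxy₂.symm⟩
  have hHz : H z := (kleinDet_ne_zero_iff _ _ hx.2).2 ⟨hz.2, hxz₂.symm⟩
  by_cases hj : Joined t h H (t x) (h x)
  · obtain ⟨g, hg, hgx, hgH⟩ := hj.exists_cycle (e := x) (Or.inl ⟨rfl, rfl⟩) hHx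
    obtain ⟨p, q, hpq, hpb⟩ := exists_kleinEnd_map _ _ hx.1 hx.2
    refine ⟨(fun e => kleinEnd p q (f₁ e)) + f₂ + fun e => kleinMul b (g e), ?_, fun e => ?_⟩
    · rw [boundary_add, boundary_add, h₂, boundary_comp_eq_zero t h _ h₁,
        boundary_comp_eq_zero t h _ hg, add_zero, add_zero]
    simp only [Pi.add_apply]
    by_cases hex : e = x
    · rw [hex, hpb, hgx, kleinMul_one]
      exact (show ∀ c : KleinFour, c ≠ 0 → c + c + c ≠ 0 by decide) b hx.2
    -- Off `x`, the image of `f₁` is `0` or `b` where `g` does not vanish.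
    have hval : f₁ e ≠ 0 → f₂ e ≠ 0 → kleinEnd p q (f₁ e) = b ∧ f₂ e ≠ b := by
      intro ha hc
      rcases hF e ha hc with rfl | rfl | rfl
      · exact absurd rfl hex
      · exact ⟨hxy₁ ▸ hpb, hxy₂.symm⟩
      · exact ⟨hxz₁ ▸ hpb, hxz₂.symm⟩
    by_cases h0 : g e = 0
    · rw [h0, map_zero, add_zero]
      by_cases ha : f₁ e = 0
      · simpa [ha] using (hcov e).resolve_left (not_not.2 ha)
      by_cases hc : f₂ e = 0
      · simpa [hc] using fun h' => ha (hpq _ h')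
      · obtain ⟨h1, h2⟩ := hval ha hc
        rw [h1]
        exact KleinFour.add_ne_zero h2.symm
    · have h1 : kleinDet b (f₂ e) ≠ 0 := hgH e hex h0
      intro h2
      have h3 := congrArg (kleinDet b) h2
      have h4 : kleinDet b (kleinEnd p q (f₁ e)) = 0 := by
        by_cases ha : f₁ e = 0
        · simp [ha]
        · rw [(hval ha ((kleinDet_ne_zero_iff _ _ hx.2).1 h1).1).1]
          by_contra h5
          exact ((kleinDet_ne_zero_iff _ _ hx.2).1 h5).2 rfl
      simp only [map_add, h4, kleinDet_kleinMul, map_zero, zero_add, add_zero] at h3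
      exact h1 h3
  · let X : α → Prop := Joined t h H (t x)
    have hXH : ∀ e, H e → (X (t e) ↔ X (h e)) := fun e he => joined_iff_of_edge he
    have hXt : X (t x) := Joined.refl _ _
    have hXh : ¬ X (h x) := hj
    have hdet := boundary_comp_eq_zero t h (kleinDet b) h₂
    have hg := boundary_restrict t h hdet X hXH
    obtain ⟨h3, h4⟩ := kempe_change h₂ hg b (fun e he => by
      by_contra h5
      simp [h5] at he)
    have hy3 := hXH y hHy
    have hz3 := hXH z hHz
    have hyz : ¬ (X (t y) ↔ X (t z)) := by
      clear_value X
      rcases htx with (h5 | h5) | (h5 | h5) <;> rcases hhx with (h6 | h6) | (h6 | h6) <;>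
        rw [h5] at hXt <;> rw [h6] at hXh <;> tauto
    refine exists_kleinFlow_of_agree h₁ h3 (fun e => (hcov e).imp_right (h4 e).1) (x := y) (y := z)
      (z := x) (fun e ha hc => or_rotate.1 (hF e ha ((h4 e).2 hc))) ⟨hy.1, (h4 y).1 hy.2⟩
      ⟨hz.1, (h4 z).1 hz.2⟩ ⟨hx.1, (h4 x).1 hx.2⟩
      (iff_of_true (hxy₁.symm.trans hxz₁) ?_)
    have h7 := add_kleinMul_kleinDet b _ _ hHy hHz hyz₂
    have h8 := add_kleinMul_kleinDet b _ _ hHz hHy hyz₂.symm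
    by_cases h9 : X (t y)
    · have h10 : ¬ X (t z) := fun h' => hyz (iff_of_true h9 h')
      simp [h9, h10, h7]
    · have h10 : X (t z) := by
        by_contra h'
        exact hyz (iff_of_false h9 h')
      simp [h9, h10, h8]

/-- If `f₂` takes distinct values at the common edges, where `f₁` is constant, and the common edges
form a star with centre `v`, then there is a nowhere-zero flow. For `c` other than `0` and the
common value, the edges with values of `f₁` other than `0` and `c` contain, by parity, a cycle that
separates the common edges, and the Kempe change along it makes `f₁` nonconstant on them. -/
lemma exists_kleinFlow_of_star (h₁ : boundary t h f₁ = 0)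
    (h₂ : boundary t h f₂ = 0) (hcov : ∀ e, f₁ e ≠ 0 ∨ f₂ e ≠ 0)
    (hF : ∀ e, f₁ e ≠ 0 → f₂ e ≠ 0 → e = x ∨ e = y ∨ e = z)
    (hx : f₁ x ≠ 0 ∧ f₂ x ≠ 0) (hy : f₁ y ≠ 0 ∧ f₂ y ≠ 0) (hz : f₁ z ≠ 0 ∧ f₂ z ≠ 0)
    (hxy₁ : f₁ x = f₁ y) (hxz₁ : f₁ x = f₁ z)
    (hxy₂ : f₂ x ≠ f₂ y) (hxz₂ : f₂ x ≠ f₂ z) (hyz₂ : f₂ y ≠ f₂ z) {v u₁ u₂ u₃ : α}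
    (hvx : HasEnds t h x v u₁) (hvy : HasEnds t h y v u₂) (hvz : HasEnds t h z v u₃) :
    ∃ f : ι → KleinFour, boundary t h f = 0 ∧ ∀ e, f e ≠ 0 := by
  classical
  have hne_y : x ≠ y := fun h' => hxy₂ (by rw [h'])
  have hne_z : x ≠ z := fun h' => hxz₂ (by rw [h'])
  have hne_yz : y ≠ z := fun h' => hyz₂ (by rw [h'])
  obtain ⟨c, hc, hcx⟩ : ∃ c : KleinFour, c ≠ 0 ∧ c ≠ f₁ x :=
    (show ∀ a : KleinFour, ∃ c : KleinFour, c ≠ 0 ∧ c ≠ a by decide) _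
  have hDx : kleinDet c (f₁ x) ≠ 0 := (kleinDet_ne_zero_iff _ _ hc).2 ⟨hx.1, hcx.symm⟩
  have hDy : kleinDet c (f₁ y) ≠ 0 := hxy₁ ▸ hDx
  have hDz : kleinDet c (f₁ z) ≠ 0 := hxz₁ ▸ hDx
  -- It suffices to find a cycle that separates `x` from `y` or from `z`.
  have finish : ∀ g : ι → ZMod 2, boundary t h g = 0 →
      (∀ e, g e ≠ 0 → kleinDet c (f₁ e) ≠ 0) → g x = 1 → g y = 0 ∨ g z = 0 →
      ∃ f : ι → KleinFour, boundary t h f = 0 ∧ ∀ e, f e ≠ 0 := by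
    intro g hg hgf hgx hgyz
    obtain ⟨h3, h4⟩ := kempe_change h₁ hg c hgf
    have hcov' := fun e => (hcov e).imp_left (h4 e).1
    rcases hgyz with h0 | h0
    · refine exists_kleinFlow_of_agree h3 h₂ hcov' (fun e ha => hF e ((h4 e).2 ha))
        ⟨(h4 x).1 hx.1, hx.2⟩ ⟨(h4 y).1 hy.1, hy.2⟩ ⟨(h4 z).1 hz.1, hz.2⟩ (iff_of_false ?_ hxy₂)
      simp [h0, hgx, hxy₁, kleinMul_one, hc]
    · refine exists_kleinFlow_of_agree h3 h₂ hcov'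
        (fun e ha hb => by have := hF e ((h4 e).2 ha) hb; tauto)
        ⟨(h4 x).1 hx.1, hx.2⟩ ⟨(h4 z).1 hz.1, hz.2⟩ ⟨(h4 y).1 hy.1, hy.2⟩ (iff_of_false ?_ hxz₂)
      simp [h0, hgx, hxz₁, kleinMul_one, hc]
  let H : ι → Prop := fun e => kleinDet c (f₁ e) ≠ 0 ∧ e ≠ x ∧ e ≠ y ∧ e ≠ z
  by_cases hjv : Joined t h H u₁ v
  · obtain ⟨g, hg, hgx, hgH⟩ := hjv.symm.exists_cycle hvx (fun h' => h'.2.1 rfl)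
    refine finish g hg (fun e he => ?_) hgx (Or.inl ?_)
    · by_cases hex : e = x
      · exact hex ▸ hDx
      · exact (hgH e hex he).1
    · by_contra h0
      exact (hgH y hne_y.symm h0).2.2.1 rfl
  by_cases hjy : Joined t h H u₁ u₂
  · obtain ⟨g, hg, hgx, hgH⟩ := hjy.exists_cycle_two hvx hvy hne_y (fun h' => h'.2.1 rfl)
    refine finish g hg (fun e he => ?_) hgx (Or.inr ?_)
    · by_cases hex : e = x
      · exact hex ▸ hDx
      · rcases hgH e hex he with h' | rfl
        exacts [h'.1, hDy]
    · by_contra h0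
      rcases hgH z hne_z.symm h0 with h' | h'
      exacts [h'.2.2.2 rfl, hne_yz h'.symm]
  by_cases hjz : Joined t h H u₁ u₃
  · obtain ⟨g, hg, hgx, hgH⟩ := hjz.exists_cycle_two hvx hvz hne_z (fun h' => h'.2.1 rfl)
    refine finish g hg (fun e he => ?_) hgx (Or.inl ?_)
    · by_cases hex : e = x
      · exact hex ▸ hDx
      · rcases hgH e hex he with h' | rfl
        exacts [h'.1, hDz]
    · by_contra h0
      rcases hgH y hne_y.symm h0 with h' | h'
      exacts [h'.2.2.1 rfl, hne_yz h']
  -- Otherwise `x` is the only edge of the even subgraph that leaves the component of `u₁`.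
  refine (not_crossing_once (boundary_comp_eq_zero t h (kleinDet c) h₁) (Joined t h H u₁) x hDx
    ?_ fun a ha h0 => ?_).elim
  · have := Joined.refl (t := t) (h := h) H u₁
    rcases hvx with ⟨h5, h6⟩ | ⟨h5, h6⟩ <;> rw [h5, h6] <;> tauto
  by_cases hay : a = y
  · subst hay
    rcases hvy with ⟨h5, h6⟩ | ⟨h5, h6⟩ <;> rw [h5, h6] <;> tauto
  by_cases haz : a = z
  · subst haz
    rcases hvz with ⟨h5, h6⟩ | ⟨h5, h6⟩ <;> rw [h5, h6] <;> tauto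
  exact joined_iff_of_edge ⟨h0, ha, hay, haz⟩

/-- The edges `e` and `e'` have a common end. -/
def Meets (t h : ι → α) (e e' : ι) : Prop :=
  ∃ v u u', HasEnds t h e v u ∧ HasEnds t h e' v u'

lemma Meets.symm {α ι : Type*} {t h : ι → α} {e e' : ι} : Meets t h e e' → Meets t h e' e :=
  fun ⟨v, u, u', hu, hu'⟩ => ⟨v, u', u, hu', hu⟩

/-- If `x` meets `y` and `z`, it does so at the same end, or both of its ends are covered. -/
lemma exists_kleinFlow_of_meets_meets (h₁ : boundary t h f₁ = 0)
    (h₂ : boundary t h f₂ = 0) (hcov : ∀ e, f₁ e ≠ 0 ∨ f₂ e ≠ 0)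
    (hF : ∀ e, f₁ e ≠ 0 → f₂ e ≠ 0 → e = x ∨ e = y ∨ e = z)
    (hx : f₁ x ≠ 0 ∧ f₂ x ≠ 0) (hy : f₁ y ≠ 0 ∧ f₂ y ≠ 0) (hz : f₁ z ≠ 0 ∧ f₂ z ≠ 0)
    (hxy₁ : f₁ x = f₁ y) (hxz₁ : f₁ x = f₁ z)
    (hxy₂ : f₂ x ≠ f₂ y) (hxz₂ : f₂ x ≠ f₂ z) (hyz₂ : f₂ y ≠ f₂ z)
    (hxy : Meets t h x y) (hxz : Meets t h x z) :
    ∃ f : ι → KleinFour, boundary t h f = 0 ∧ ∀ e, f e ≠ 0 := by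
  obtain ⟨v, u, u₂, hv, hvy⟩ := hxy
  obtain ⟨w, u', u₃, hw, hwz⟩ := hxz
  by_cases hvw : v = w
  · subst hvw
    exact exists_kleinFlow_of_star h₁ h₂ hcov hF hx hy hz hxy₁ hxz₁ hxy₂ hxz₂ hyz₂ hv hvy hwz
  · have hy' : v = t y ∨ v = h y := hvy.imp (fun h' => h'.1.symm) fun h' => h'.2.symm
    have hz' : w = t z ∨ w = h z := hwz.imp (fun h' => h'.1.symm) fun h' => h'.2.symm
    have hxvw : (t x = v ∧ h x = w) ∨ (t x = w ∧ h x = v) := by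
      rcases hv with ⟨rfl, rfl⟩ | ⟨rfl, rfl⟩ <;> rcases hw with ⟨rfl, rfl⟩ | ⟨rfl, rfl⟩ <;> simp_all
    refine exists_kleinFlow_of_covered h₁ h₂ hcov hF hx hy hz hxy₁ hxz₁ hxy₂ hxz₂ hyz₂ ?_ ?_ <;>
      rcases hxvw with ⟨h5, h6⟩ | ⟨h5, h6⟩ <;> simp only [h5, h6] <;> tauto

lemma exists_kleinFlow_of_meets (h₁ : boundary t h f₁ = 0)
    (h₂ : boundary t h f₂ = 0) (hcov : ∀ e, f₁ e ≠ 0 ∨ f₂ e ≠ 0)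
    (hF : ∀ e, f₁ e ≠ 0 → f₂ e ≠ 0 → e = x ∨ e = y ∨ e = z)
    (hx : f₁ x ≠ 0 ∧ f₂ x ≠ 0) (hy : f₁ y ≠ 0 ∧ f₂ y ≠ 0) (hz : f₁ z ≠ 0 ∧ f₂ z ≠ 0)
    (hxy₁ : f₁ x = f₁ y) (hxz₁ : f₁ x = f₁ z)
    (hxy₂ : f₂ x ≠ f₂ y) (hxz₂ : f₂ x ≠ f₂ z) (hyz₂ : f₂ y ≠ f₂ z)
    (mx : Meets t h x y ∨ Meets t h x z) (my : Meets t h y x ∨ Meets t h y z)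
    (mz : Meets t h z x ∨ Meets t h z y) :
    ∃ f : ι → KleinFour, boundary t h f = 0 ∧ ∀ e, f e ≠ 0 := by
  have hx' : Meets t h x y → Meets t h x z →
      ∃ f : ι → KleinFour, boundary t h f = 0 ∧ ∀ e, f e ≠ 0 :=
    exists_kleinFlow_of_meets_meets h₁ h₂ hcov hF hx hy hz hxy₁ hxz₁ hxy₂ hxz₂ hyz₂
  rcases mx with m | m
  · rcases mz with m' | m'
    · exact hx' m m'.symm
    · exact exists_kleinFlow_of_meets_meets h₁ h₂ hcov
        (fun e ha hb => by have := hF e ha hb; tauto) hy hx hz hxy₁.symm (hxy₁.symm.trans hxz₁)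
        hxy₂.symm hyz₂ hxz₂ m.symm m'.symm
  · rcases my with m' | m'
    · exact hx' m'.symm m
    · exact exists_kleinFlow_of_meets_meets h₁ h₂ hcov
        (fun e ha hb => by have := hF e ha hb; tauto) hz hx hy hxz₁.symm (hxz₁.symm.trans hxy₁)
        hxz₂.symm hyz₂.symm hxy₂ m.symm m'.symm

/-- Two Klein flows that cover all edges, and have at most three common edges, each of which meets
another one, combine to a nowhere-zero Klein flow. -/
theorem exists_kleinFlow_of_union (h₁ : boundary t h f₁ = 0)
    (h₂ : boundary t h f₂ = 0) (hcov : ∀ e, f₁ e ≠ 0 ∨ f₂ e ≠ 0)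
    (hcard : {e | f₁ e ≠ 0 ∧ f₂ e ≠ 0}.ncard ≤ 3)
    (hmeet : ∀ e e', e ≠ e' → (f₁ e ≠ 0 ∧ f₂ e ≠ 0) → (f₁ e' ≠ 0 ∧ f₂ e' ≠ 0) →
      ∃ e'', e'' ≠ e ∧ (f₁ e'' ≠ 0 ∧ f₂ e'' ≠ 0) ∧ Meets t h e e'') :
    ∃ f : ι → KleinFour, boundary t h f = 0 ∧ ∀ e, f e ≠ 0 := by
  have hcases : {e | f₁ e ≠ 0 ∧ f₂ e ≠ 0}.ncard = 0 ∨ {e | f₁ e ≠ 0 ∧ f₂ e ≠ 0}.ncard = 1 ∨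
      {e | f₁ e ≠ 0 ∧ f₂ e ≠ 0}.ncard = 2 ∨ {e | f₁ e ≠ 0 ∧ f₂ e ≠ 0}.ncard = 3 := by omega
  rw [Set.ncard_eq_zero, Set.ncard_eq_one, Set.ncard_eq_two, Set.ncard_eq_three] at hcases
  simp only [Set.ext_iff, Set.mem_ofPred_eq, Set.mem_empty_iff_false, Set.mem_singleton_iff,
    Set.mem_insert_iff] at hcases
  rcases hcases with hF | ⟨x, hF⟩ | ⟨x, y, -, hF⟩ | ⟨x, y, z, hxy, hxz, hyz, hF⟩
  · refine ⟨f₁ + f₂, by rw [boundary_add, h₁, h₂, add_zero], fun e => ?_⟩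
    by_cases h0 : f₁ e = 0
    · simpa [h0] using hcov e
    · have h0' : f₂ e = 0 := by
        by_contra h'
        exact (hF e).1 ⟨h0, h'⟩
      simpa [h0'] using h0
  · have hx := (hF x).2 rfl
    exact exists_kleinFlow_of_agree h₁ h₂ hcov (fun e ha hb => Or.inl ((hF e).1 ⟨ha, hb⟩))
      hx hx hx (by simp)
  · have hx := (hF x).2 (Or.inl rfl)
    have hy := (hF y).2 (Or.inr rfl)
    exact exists_kleinFlow_of_agree h₁ h₂ hcov (x := y) (y := y) (z := x)
      (fun e ha hb => by have := (hF e).1 ⟨ha, hb⟩; tauto) hy hy hx (by simp)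
  have hx := (hF x).2 (by simp)
  have hy := (hF y).2 (by simp)
  have hz := (hF z).2 (by simp)
  have hF' := fun e ha hb => (hF e).1 ⟨ha, hb⟩
  by_cases pxy : f₁ x = f₁ y ↔ f₂ x = f₂ y
  · exact exists_kleinFlow_of_agree h₁ h₂ hcov hF' hx hy hz pxy
  by_cases pxz : f₁ x = f₁ z ↔ f₂ x = f₂ z
  · exact exists_kleinFlow_of_agree h₁ h₂ hcov
      (fun e ha hb => by have := hF' e ha hb; tauto) hx hz hy pxz
  by_cases pyz : f₁ y = f₁ z ↔ f₂ y = f₂ z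
  · exact exists_kleinFlow_of_agree h₁ h₂ hcov
      (fun e ha hb => by have := hF' e ha hb; tauto) hy hz hx pyz
  have mx : Meets t h x y ∨ Meets t h x z := by
    obtain ⟨e, hne, he, hm⟩ := hmeet x y hxy hx hy
    rcases (hF e).1 he with rfl | rfl | rfl <;> tauto
  have my : Meets t h y x ∨ Meets t h y z := by
    obtain ⟨e, hne, he, hm⟩ := hmeet y x hxy.symm hy hx
    rcases (hF e).1 he with rfl | rfl | rfl <;> tauto
  have mz : Meets t h z x ∨ Meets t h z y := by
    obtain ⟨e, hne, he, hm⟩ := hmeet z x hxz.symm hz hx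
    rcases (hF e).1 he with rfl | rfl | rfl <;> tauto
  -- Two complementary equivalence relations on three edges: one is equality, the other is full.
  have hsplit : (f₁ x = f₁ y ∧ f₁ x = f₁ z ∧ f₂ x ≠ f₂ y ∧ f₂ x ≠ f₂ z ∧ f₂ y ≠ f₂ z) ∨
      (f₂ x = f₂ y ∧ f₂ x = f₂ z ∧ f₁ x ≠ f₁ y ∧ f₁ x ≠ f₁ z ∧ f₁ y ≠ f₁ z) := by
    grind
  rcases hsplit with ⟨a, b, c, d, e⟩ | ⟨a, b, c, d, e⟩
  · exact exists_kleinFlow_of_meets h₁ h₂ hcov hF' hx hy hz a b c d e mx my mz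
  · exact exists_kleinFlow_of_meets h₂ h₁ (fun e => (hcov e).symm) (fun e ha hb => hF' e hb ha)
      hx.symm hy.symm hz.symm a b c d e mx my mz

end Combine

/-! ### Flows of graphs -/

section Graphs

variable {α β : Type*} {G Γ : Graph α β}

lemma nonempty_orientation (G : Graph α β) : Nonempty G.Orientation := by
  have hex : ∀ e : E(G), ∃ p : α × α, G.IsLink e p.1 p.2 := fun e => by
    obtain ⟨x, y, hxy⟩ := exists_isLink_of_mem_edgeSet e.2
    exact ⟨(x, y), hxy⟩
  choose p hp using hex
  exact ⟨⟨fun e => (p e).1, fun e => (p e).2, hp⟩⟩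

lemma isFlow_iff_boundary_eq_zero {A : Type*} [AddCommGroup A] [Fintype E(G)] (D : G.Orientation)
    (φ : E(G) → A) : IsFlow D φ ↔ boundary D.tail D.head φ = 0 := by
  classical
  have hb : ∀ v, boundary D.tail D.head φ v = 0 ↔
      ∑ᶠ (e : E(G)) (_ : D.tail e = v), φ e = ∑ᶠ (e : E(G)) (_ : D.head e = v), φ e := by
    intro v
    simp only [boundary_apply, finsum_eq_if, finsum_eq_sum_of_fintype]
    rw [sub_eq_zero, eq_comm]
  refine ⟨fun hf => ?_, fun hf v _ => (hb v).1 (by rw [hf, Finsupp.zero_apply])⟩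
  ext v
  rw [Finsupp.zero_apply]
  by_cases hv : v ∈ V(G)
  · exact (hb v).2 (hf v hv)
  · have ht : ∀ e, D.tail e ≠ v := fun e he => hv (he ▸ (D.isLink e).left_mem)
    have hh : ∀ e, D.head e ≠ v := fun e he => hv (he ▸ (D.isLink e).right_mem)
    simp [boundary_apply, ht, hh]

lemma Orientation.hasEnds_iff (D : G.Orientation) {e : E(G)} {x y : α} :
    HasEnds D.tail D.head e x y ↔ G.IsLink e x y := by
  rw [(D.isLink e).isLink_iff]
  unfold HasEnds
  tauto

/-- A nowhere-zero 4-flow of a subgraph gives a Klein flow of the whole graph that vanishes exactly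
off the subgraph; as `-1 = 1` modulo 2, it is a flow for any orientation. -/
lemma HasNowhereZeroFlow.exists_kleinFlow [Fintype E(Γ)] (hle : G ≤ Γ)
    (hG : G.HasNowhereZeroFlow 4) (D : Γ.Orientation) :
    ∃ f : E(Γ) → KleinFour, boundary D.tail D.head f = 0 ∧ ∀ e, f e ≠ 0 ↔ e.1 ∈ E(G) := by
  classical
  have hsub : E(G) ⊆ E(Γ) := IsSubgraph.edgeSet_mono hle
  have : Fintype E(G) := (Set.toFinite E(Γ) |>.subset hsub).fintype
  obtain ⟨D', φ, hφ, h0⟩ := hG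
  obtain ⟨f, hf, hf0⟩ :=
    exists_kleinFlow_of_intFlow ((isFlow_iff_boundary_eq_zero D' φ).1 hφ) (mod_cast h0)
  refine ⟨fun e => if he : e.1 ∈ E(G) then f ⟨e, he⟩ else 0, ?_, fun e => ?_⟩
  · rw [← hf]
    refine (Fintype.sum_of_injective (Set.inclusion hsub) (Set.inclusion_injective hsub) _ _
      (fun e he => ?_) fun e => ?_).symm
    · have he' : e.1 ∉ E(G) := fun h' => he ⟨⟨e, h'⟩, rfl⟩
      simp [he']
    · have hneg : ∀ (m : KleinFour) (x y : α),
          single x m - single y m = single y m - single x m := by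
        intro m x y
        have hm : -m = m := (show ∀ m : KleinFour, -m = m by decide) m
        rw [sub_eq_add_neg, sub_eq_add_neg, ← single_neg, ← single_neg, hm, add_comm]
      have he' : (Set.inclusion hsub e).1 ∈ E(G) := e.2
      simp only [he', dif_pos]
      rcases (D.isLink (Set.inclusion hsub e)).eq_and_eq_or_eq_and_eq ((D'.isLink e).mono hle)
        with ⟨h1, h2⟩ | ⟨h1, h2⟩
      · rw [h1, h2]
      · rw [h1, h2, hneg]
  · by_cases he : e.1 ∈ E(G) <;> simp [he, hf0]

/-- In a connected subgraph that is induced by edges, no edge is isolated from the others. -/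
lemma exists_common_end {F : Set β} (hF : (Γ.edgeInduce F).IsConnected) {e e' : β} (he : e ∈ E(Γ))
    (heF : e ∈ F) (he' : e' ∈ E(Γ)) (heF' : e' ∈ F) (hne : e ≠ e') :
    ∃ e'' ∈ F, e'' ≠ e ∧ ∃ v u u', Γ.IsLink e v u ∧ Γ.IsLink e'' v u' := by
  by_contra! hno
  obtain ⟨a, b, hab⟩ := exists_isLink_of_mem_edgeSet he
  obtain ⟨c, d, hcd⟩ := exists_isLink_of_mem_edgeSet he'
  -- The ends of `e` are closed under adjacency.
  have hclosed : ∀ x y : V(Γ.edgeInduce F), (Γ.edgeInduce F).toSimpleGraph.Walk x y →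
      Γ.Inc e x → Γ.Inc e y := by
    intro x y p
    induction p with
    | nil => exact id
    | cons hadj _ ih =>
      rintro ⟨w, hw⟩
      obtain ⟨k, hkF, hk⟩ := hadj.2
      by_cases hke : k = e
      · exact ih (hke ▸ hk.inc_right)
      · exact absurd hk (hno k hkF hke _ _ _ hw)
  obtain ⟨p⟩ := hF ⟨a, e, heF, b, hab⟩ ⟨c, e', heF', d, hcd⟩
  obtain ⟨w, hw⟩ := hclosed _ _ p ⟨b, hab⟩
  exact hno e' heF' hne.symm _ _ _ hw hcd

end Graphs

end Graph

open scoped Graph in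
/-- If a finite loopless multigraph `Γ` is the union of two subgraphs that both admit nowhere-zero
4-flows, and whose common edges are at most three and induce a connected subgraph of `Γ`, then `Γ`
admits a nowhere-zero 4-flow. -/
theorem theorem4p2 {α β : Type*} (Γ Γ₁ Γ₂ : Graph α β)
    (hV : V(Γ).Finite) (hE : E(Γ).Finite) (hloop : Γ.Loopless)
    (hunion : Γ.IsUnionOf Γ₁ Γ₂)
    (hcard : (E(Γ₁) ∩ E(Γ₂)).ncard ≤ 3)
    (hconn : (Γ.edgeInduce (E(Γ₁) ∩ E(Γ₂))).IsConnected)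
    (h₁ : Γ₁.HasNowhereZeroFlow 4) (h₂ : Γ₂.HasNowhereZeroFlow 4) :
    Γ.HasNowhereZeroFlow 4 := by
  classical
  have : Fintype E(Γ) := hE.fintype
  obtain ⟨D⟩ := Γ.nonempty_orientation
  obtain ⟨f₁, hf₁, hs₁⟩ := h₁.exists_kleinFlow hunion.left_le D
  obtain ⟨f₂, hf₂, hs₂⟩ := h₂.exists_kleinFlow hunion.right_le D
  obtain ⟨f, hf, hf0⟩ := Graph.exists_kleinFlow_of_union hf₁ hf₂
    (fun e => by
      rw [hs₁, hs₂]
      exact hunion.edgeSet_eq.subset e.2)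
    (by
      simp only [hs₁, hs₂]
      refine le_trans ?_ hcard
      rw [← Set.ncard_image_of_injective _ Subtype.val_injective]
      refine Set.ncard_le_ncard ?_ (hE.subset fun e he => hunion.edgeSet_eq.symm.subset (Or.inl he.1))
      rintro _ ⟨e, he, rfl⟩
      exact he)
    (by
      intro e e' hne he he'
      simp only [hs₁, hs₂] at he he' ⊢
      obtain ⟨k, hkF, hke, v, u, u', hu, hu'⟩ := Graph.exists_common_end hconn e.2 he e'.2 he'
        (fun h' => hne (Subtype.ext h'))
      exact ⟨⟨k, hu'.edge_mem⟩, fun h' => hke (congrArg Subtype.val h'), hkF, v, u, u',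
        D.hasEnds_iff.2 hu, D.hasEnds_iff.2 hu'⟩)
  obtain ⟨φ, hφ, hφ0⟩ := Graph.exists_intFlow_of_kleinFlow hf hf0
  exact ⟨D, φ, (Graph.isFlow_iff_boundary_eq_zero D φ).2 hφ, mod_cast hφ0⟩
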